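/- Let $\mathbb{F}_q$ be the finite field with $q$ elements, $\mathbb{F}_{q^m}$ its extension of degree $m$, and let $n\le m$, $k\ge 1$, $w\ge 0$, $\delta\ge 0$ be integers. For $x\in\mathbb{F}_{q^m}^n$ let $\mathrm{rank}(x)$ be the dimension of the $\mathbb{F}_q$-span of the entries of $x$. Let $g_1,\dots,g_n\in\mathbb{F}_{q^m}$ be linearly independent over $\mathbb{F}_q$, and let $Gab_k(g)\subseteq\mathbb{F}_{q^m}^n$ be the Gabidulin code generated over $\mathbb{F}_{q^m}$ by the rows $(g_1^{q^i},\dots,g_n^{q^i})$, $0\le i<k$. Put $\xi:=w-\frac{n-k}{2}$ and assume $2\xi\le\delta\le n-k$. For a full-rank matrix $B\in\mathbb{F}_q^{\delta\times n}$, the error-erasure decoder, applied to $r\in\mathbb{F}_{q^m}^n$ with column erasures $B$, outputs the (necessarily unique) codeword $c\in Gab_k(g)$ such that $r-c=a_CB+a_EB_E$ for some $t\ge 0$ with $2t+\delta\le n-k$, $a_C\in\mathbb{F}_{q^m}^{\delta}$, $a_E\in\mathbb{F}_{q^m}^{t}$ and $B_E\in\mathbb{F}_q^{t\times n}$, if there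 is one, and reports a failure otherwise. Let $r$ be uniformly distributed on $\mathbb{F}_{q^m}^n$ and let $\mathcal{U}$ be, independently, uniformly distributed on the set of $\delta$-dimensional subspaces of $\mathbb{F}_q^n$ (the guess of the error row space). Then the probability that the error-erasure decoder, applied to $r$ with column erasures a basis of $\mathcal{U}$, outputs a codeword $c\in Gab_k(g)$ with $\mathrm{rank}(r-c)\le w$ is at most $$\sum_{j=0}^{w}\bar A_j P_{n,k,\delta,j},$$ and $$\sum_{j=0}^{w}\bar A_j P_{n,k,\delta,j}\le 64\,n\,q^{\,m(k-n)+w(n+m)-w^2-\left\lceil\frac{\delta}{2}+w-\frac{n-k}{2}\right\rceil\left(\frac{n+k}{2}-\left\lceil\frac{\delta}{2}\right\rceil\right)}.$$ Here $$\bar A_j=q^{m(k-n)}\prod_{i=0}^{j-1}\frac{(q^m-q^i)(q^n-q^i)}{q^j-q^i},$$ which for every $j\ge 0$ is the average, over all $r\in\mathbb{F}_{q^m}^n$, of the number of codewords $c\in Gab_k(g)$ with $\mathrm{rank}(r-c)=j$; and, with $\binom{a}{b}_q=\prod_{i=0}^{b-1}\frac{q^a-q^i}{q^b-q^i}$ the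 Gaussian binomial coefficient, $$P_{n,k,\delta,j}=\binom{n}{\delta}_q^{-1}\sum_{i=\lceil j-\frac{n-k}{2}+\frac{\delta}{2}\rceil}^{\min\{\delta,j\}}\binom{n-j}{\delta-i}_q\binom{j}{i}_q\,q^{(j-i)(\delta-i)}$$ if $2j+\delta>n-k$, and $P_{n,k,\delta,j}=1$ otherwise. -/

import Mathlib

namespace GabidulinDecoding

noncomputable section

/-! ### Rank metric and Gabidulin codes -/

section Codes

variable (F : Type*) {L : Type*} [Field F] [Fintype F] [Field L] [Algebra F L]

/-- The `F`-rank of a vector over `L`: the `F`-dimension of the span of its entries. -/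
def rankWeight {n : ℕ} (x : Fin n → L) : ℕ :=
  Module.finrank F (Submodule.span F (Set.range x))

/-- The generator matrix with `(i, j)` entry `g j ^ (q ^ i)`, `0 ≤ i < k`, where `q = |F|`. -/
def gabGenerator {n : ℕ} (k : ℕ) (g : Fin n → L) : Matrix (Fin k) (Fin n) L :=
  Matrix.of fun i j => g j ^ (Fintype.card F ^ (i : ℕ))

/-- The Gabidulin code `Gab_k(g)`: the row space of its generator matrix. -/
def gabCode {n : ℕ} (k : ℕ) (g : Fin n → L) : Submodule L (Fin n → L) :=
  Submodule.span L (Set.range (gabGenerator F k g).row)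

/-- `c` lies within the error-erasure correction radius of `r`, when the rows of `B` are used as
`δ` column erasures and the code has length `n` and dimension `k`: the error `r - c` is
`a_C B + a_E B_E` with unknown `a_C`, `a_E`, `B_E`, where `a_E B_E` accounts for `t` full errors
and `2 t + δ ≤ n - k`. -/
def Correctable {n δ : ℕ} (k : ℕ) (r : Fin n → L) (B : Matrix (Fin δ) (Fin n) F)
    (c : Fin n → L) : Prop :=
  ∃ t : ℕ, 2 * t + δ + k ≤ n ∧
    ∃ (aC : Fin δ → L) (aE : Fin t → L) (BE : Matrix (Fin t) (Fin n) F),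
      r - c = Matrix.vecMul aC (B.map (algebraMap F L)) +
        Matrix.vecMul aE (BE.map (algebraMap F L))

open Classical in
/-- The (bounded-distance) error-erasure decoder of `Gab_k(g)` for the column erasures `B`: it
returns the codeword within the error-erasure correction radius of `r` if there is one (it is then
unique, because the minimum rank distance of the code is `n - k + 1`), and `none` otherwise. -/
def errorErasureDecode {n δ : ℕ} (k : ℕ) (g : Fin n → L) (r : Fin n → L)
    (B : Matrix (Fin δ) (Fin n) F) : Option (Fin n → L) :=
  if h : ∃ c ∈ gabCode F k g, Correctable F k r B c then some h.choose else none

end Codes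

/-! ### Random guesses -/

/-- The set of `δ`-dimensional subspaces of `F ^ n`. -/
abbrev Grass (F : Type*) [Field F] (n δ : ℕ) : Type _ :=
  {U : Submodule F (Fin n → F) // Module.finrank F U = δ}

/-- A full-rank `δ × n` matrix whose row space is `U`. -/
def basisMatrix {F : Type*} [Field F] {n δ : ℕ} (U : Grass F n δ) : Matrix (Fin δ) (Fin n) F :=
  Matrix.of fun i => (Module.finBasisOfFinrankEq F U.1 U.2 i : Fin n → F)

/-- The probability of `E` under the uniform distribution on the finite type `Ω`, all of whose
subsets are events. -/
def uniformProb (Ω : Type*) (E : Set Ω) : ℝ :=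
  letI : MeasurableSpace Ω := ⊤
  (ProbabilityTheory.uniformOn (Set.univ : Set Ω)).real E

/-- The event, on pairs (received word, guess of the error row space), that the error-erasure
decoder run with the guessed space as column erasures outputs a codeword at rank distance at most
`w` from the received word. -/
def successEvent (F : Type*) {L : Type*} [Field F] [Fintype F] [Field L] [Algebra F L]
    {n : ℕ} (k δ w : ℕ) (g : Fin n → L) : Set ((Fin n → L) × Grass F n δ) :=
  {x | ∃ c, errorErasureDecode F k g x.1 (basisMatrix x.2) = some c ∧
    rankWeight F (x.1 - c) ≤ w}

/-- The average, over all received words `r`, of the number of codewords of `Gab_k(g)` at rank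
distance exactly `j` from `r`. -/
def averageCodewords (F : Type*) {L : Type*} [Field F] [Fintype F] [Field L] [Fintype L]
    [Algebra F L] {n : ℕ} (k : ℕ) (g : Fin n → L) (j : ℕ) : ℝ :=
  Finset.expect Finset.univ fun r : Fin n → L =>
    (Set.ncard {c : Fin n → L | c ∈ gabCode F k g ∧ rankWeight F (r - c) = j} : ℝ)

/-! ### The quantities in the bound -/

/-- The Gaussian binomial coefficient: the number of `k`-dimensional subspaces of `F_q ^ n`. -/
def gaussBinom (q n k : ℕ) : ℝ :=
  ∏ i ∈ Finset.range k, ((q : ℝ) ^ n - (q : ℝ) ^ i) / ((q : ℝ) ^ k - (q : ℝ) ^ i)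

/-- `P_{n,k,δ,j}`. -/
def guessProb (q n k δ j : ℕ) : ℝ :=
  if n < 2 * j + δ + k then
    (∑ i ∈ Finset.Icc ⌈(j : ℝ) - ((n : ℝ) - k) / 2 + (δ : ℝ) / 2⌉₊ (min δ j),
      gaussBinom q (n - j) (δ - i) * gaussBinom q j i * (q : ℝ) ^ ((j - i) * (δ - i))) /
      gaussBinom q n δ
  else 1

/-- `Ā_j = q ^ (m (k - n)) ∏_{i < j} (q ^ m - q ^ i) (q ^ n - q ^ i) / (q ^ j - q ^ i)`. -/
def Abar (q m n k j : ℕ) : ℝ :=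
  (q : ℝ) ^ ((m : ℤ) * ((k : ℤ) - n)) *
    ∏ i ∈ Finset.range j,
      ((q : ℝ) ^ m - (q : ℝ) ^ i) * ((q : ℝ) ^ n - (q : ℝ) ^ i) / ((q : ℝ) ^ j - (q : ℝ) ^ i)

/-- The excess `ξ = w - (n - k) / 2` of the error weight over the unique decoding radius. -/
def excess (n k w : ℕ) : ℝ := (w : ℝ) - ((n : ℝ) - k) / 2

end

end GabidulinDecoding

/-! If the decoder succeeds on `(r, U)` with output `c`, then `e = r - c` has some rank `j ≤ w` and
is correctable with `U` as erasures, and `(c, e, U)` determines `(r, U)`. So the successes number at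
most the sum over `j` of |code| · #{`e` of rank `j`} · max #{correctable `U`}. Divided by the number
of pairs `(r, U)`, the first two factors give `Abar` (`Abar_eq`) and the third is at most
`guessProb` (`card_correctable_le`). The latter holds because `U` must meet the row space of `e` in
dimension at least `j - (n-k)/2 + δ/2` (`Correctable.le_finrank_inf`), and subspaces with prescribed
intersection dimension are counted by bases.

For the closed form, Gaussian binomials are powers of `q` up to a factor 32/9. Relative to the
number of all guesses, the `i`-th term of `guessProb` is about `q ^ (-i(n-j+i-δ))`, so the first
term dominates (`guessProb_le`). The resulting exponent is nondecreasing in `j` up to `w`, so each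
of the `w + 1 ≤ n` summands is bounded by the estimate at `j = w`. -/

namespace GabidulinDecoding

open Module

/-! ### Counting tuples and subspaces -/

theorem card_eq_mul_of_fiber {α β : Type*} [Finite α] [Finite β] (f : α → β) (N : ℕ)
    (h : ∀ b, Nat.card {a // f a = b} = N) : Nat.card α = Nat.card β * N := by
  have := Fintype.ofFinite β
  rw [← Nat.card_congr (Equiv.sigmaFiberEquiv f), Nat.card_sigma]
  simp [h]

/-- The number of linearly independent `k`-tuples in `F_q ^ n`. -/
noncomputable def indepCount (q n k : ℕ) : ℝ := ∏ i ∈ Finset.range k, ((q : ℝ) ^ n - (q : ℝ) ^ i)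

theorem indepCount_pos {q n k : ℕ} (hq : 1 < q) (hk : k ≤ n) : 0 < indepCount q n k := by
  refine Finset.prod_pos fun i hi => sub_pos.2 ?_
  have := Finset.mem_range.1 hi
  exact pow_lt_pow_right₀ (by exact_mod_cast hq) (by omega)

/-- The factor at `i = n` is zero, so the counting identities below need no bound on the tuple
length. -/
theorem indepCount_eq_zero {q n k : ℕ} (hk : n < k) : indepCount q n k = 0 :=
  Finset.prod_eq_zero (Finset.mem_range.2 hk) (sub_self _)

section

variable {F V : Type*} [Field F] [Fintype F] [AddCommGroup V] [Module F V] [Finite V]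

theorem card_linearIndependent_eq (k : ℕ) :
    (Nat.card {s : Fin k → V // LinearIndependent F s} : ℝ) =
      indepCount (Fintype.card F) (finrank F V) k := by
  have hq : 0 < Fintype.card F := Fintype.card_pos
  by_cases hk : k ≤ finrank F V
  · rw [card_linearIndependent hk, indepCount, ← Fin.prod_univ_eq_prod_range
      (fun i => ((Fintype.card F : ℝ) ^ finrank F V - (Fintype.card F : ℝ) ^ i))]
    push_cast
    refine Finset.prod_congr rfl fun i _ => ?_
    rw [Nat.cast_sub (Nat.pow_le_pow_right hq (by omega))]
    push_cast; rfl
  · rw [indepCount_eq_zero (by omega)]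
    have : IsEmpty {s : Fin k → V // LinearIndependent F s} :=
      ⟨fun s => hk (by simpa using s.2.fintype_card_le_finrank)⟩
    simp

theorem card_real_eq_pow_finrank (W : Submodule F V) :
    (Nat.card W : ℝ) = (Fintype.card F : ℝ) ^ finrank F W := by
  have := Fintype.ofFinite W
  rw [Nat.card_eq_fintype_card, card_eq_pow_finrank (K := F)]; push_cast; rfl

omit [Fintype F] in
theorem span_range_eq_of_linearIndependent {U : Submodule F V} {d : ℕ} (hU : finrank F U = d)
    {s : Fin d → V} (hs : LinearIndependent F s) (hmem : ∀ i, s i ∈ U) :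
    Submodule.span F (Set.range s) = U := by
  apply Submodule.eq_of_le_of_finrank_eq
  · exact Submodule.span_le.2 (Set.range_subset_iff.2 hmem)
  · rw [finrank_span_eq_card hs, hU, Fintype.card_fin]

/-- Linearly independent tuples of a submodule, as tuples of the ambient space. -/
def indepTupleEquiv (U : Submodule F V) (d : ℕ) :
    {s : Fin d → U // LinearIndependent F s} ≃
      {s : Fin d → V // LinearIndependent F s ∧ ∀ i, s i ∈ U} where
  toFun s := ⟨fun i => s.1 i, s.2.map' U.subtype U.ker_subtype, fun i => (s.1 i).2⟩
  invFun s := ⟨fun i => ⟨s.1 i, s.2.2 i⟩, LinearIndependent.of_comp U.subtype s.2.1⟩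
  left_inv _ := rfl
  right_inv _ := rfl

/-- Double counting: sending an independent tuple to its span has as fibre over `U` the ordered
bases of `U`. -/
theorem card_subspaces_mul (d : ℕ) :
    (Nat.card {U : Submodule F V // finrank F U = d} : ℝ) * indepCount (Fintype.card F) d d =
      indepCount (Fintype.card F) (finrank F V) d := by
  rw [← card_linearIndependent_eq (V := V)]
  let f : {s : Fin d → V // LinearIndependent F s} → {U : Submodule F V // finrank F U = d} :=
    fun s => ⟨Submodule.span F (Set.range s.1), by simpa using finrank_span_eq_card s.2⟩
  have hcard (U : {U : Submodule F V // finrank F U = d}) :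
      (Nat.card {s // f s = U} : ℝ) = indepCount (Fintype.card F) d d := by
    rw [← congrArg (fun x => indepCount _ x d) U.2, ← card_linearIndependent_eq,
      Nat.card_congr (indepTupleEquiv U.1 d)]
    congr 1
    refine Nat.card_congr ?_
    refine (Equiv.subtypeSubtypeEquivSubtypeInter (fun s : Fin d → V => LinearIndependent F s)
      (fun s => ∀ i, s i ∈ U.1)).symm.trans ?_ |>.symm
    refine Equiv.subtypeEquivRight fun s => ?_
    constructor
    · intro h
      exact Subtype.ext (span_range_eq_of_linearIndependent U.2 s.2 h)
    · rintro rfl i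
      exact Submodule.subset_span ⟨i, rfl⟩
  by_cases he : Nonempty {U : Submodule F V // finrank F U = d}
  · obtain ⟨U₀⟩ := he
    rw [card_eq_mul_of_fiber f (Nat.card {s // f s = U₀})
      (fun b => by exact_mod_cast (hcard b).trans (hcard U₀).symm)]
    push_cast; rw [hcard]
  · have h1 : IsEmpty {U : Submodule F V // finrank F U = d} := not_nonempty_iff.1 he
    have h2 : IsEmpty {s : Fin d → V // LinearIndependent F s} := ⟨fun s => h1.false (f s)⟩
    simp

/-- Each vector of the quotient has `|E|` lifts, so each independent `d`-tuple there has `|E| ^ d`.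
-/
theorem card_linearIndependent_mkQ (E : Submodule F V) (d : ℕ) :
    (Nat.card {t : Fin d → V // LinearIndependent F (E.mkQ ∘ t)} : ℝ) =
      (Fintype.card F : ℝ) ^ (finrank F E * d) *
        indepCount (Fintype.card F) (finrank F V - finrank F E) d := by
  have : Finite (V ⧸ E) := Finite.of_surjective _ E.mkQ_surjective
  have hfin : finrank F V - finrank F E = finrank F (V ⧸ E) := by
    have := E.finrank_quotient_add_finrank; omega
  rw [hfin, ← card_linearIndependent_eq (V := V ⧸ E), pow_mul, ← card_real_eq_pow_finrank]
  let f : {t : Fin d → V // LinearIndependent F (E.mkQ ∘ t)} →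
    {s : Fin d → V ⧸ E // LinearIndependent F s} := fun t => ⟨E.mkQ ∘ t.1, t.2⟩
  rw [card_eq_mul_of_fiber f (Nat.card E ^ d)]
  · push_cast; ring
  · intro s
    choose r hr using fun i => E.mkQ_surjective (s.1 i)
    have hmem (t : {t // f t = s}) (i : Fin d) : t.1.1 i - r i ∈ E := by
      refine (Submodule.Quotient.eq E).1 (Eq.trans ?_ (hr i).symm)
      exact congrFun (congrArg Subtype.val t.2) i
    have hadd (e : Fin d → E) : E.mkQ ∘ (fun i => r i + (e i : V)) = s.1 := by
      funext i
      have : E.mkQ (e i : V) = 0 := by simp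
      simp only [Function.comp_apply, map_add, hr, this, add_zero]
    have e : {t // f t = s} ≃ (Fin d → E) :=
      { toFun := fun t i => ⟨t.1.1 i - r i, hmem t i⟩
        invFun := fun e => ⟨⟨fun i => r i + (e i : V), by rw [hadd]; exact s.2⟩,
          Subtype.ext (hadd e)⟩
        left_inv := fun t => by ext; simp
        right_inv := fun e => by ext; simp }
    rw [Nat.card_congr e, Nat.card_fun, Nat.card_fin]

/-- The number of `(i + d)`-dimensional subspaces that meet `E` in dimension `i`. -/
theorem card_subspaces_inf_mul_le (E : Submodule F V) (i d : ℕ) :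
    (Nat.card {U : Submodule F V // finrank F U = i + d ∧ finrank F (U ⊓ E : Submodule F V) = i} :
        ℝ) * (indepCount (Fintype.card F) i i *
          ((Fintype.card F : ℝ) ^ (i * d) * indepCount (Fintype.card F) d d)) ≤
      indepCount (Fintype.card F) (finrank F E) i *
        ((Fintype.card F : ℝ) ^ (finrank F E * d) *
          indepCount (Fintype.card F) (finrank F V - finrank F E) d) := by
  let G := {U : Submodule F V // finrank F U = i + d ∧ finrank F (U ⊓ E : Submodule F V) = i}
  let W (U : G) : Submodule F U.1 := E.comap U.1.subtype
  have hW (U : G) : finrank F (W U) = i := by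
    refine Eq.trans ?_ U.2.2
    rw [← Submodule.map_comap_subtype]
    exact (Submodule.equivMapOfInjective _ U.1.subtype_injective _).finrank_eq
  -- `T U` consists of an ordered basis of `U ⊓ E` and a `d`-tuple that is a basis of `U` modulo `U
  -- ⊓ E`. Together they span `U`, so forgetting `U` is injective, which suffices for an upper
  -- bound.
  let T (U : G) := {s : Fin i → W U // LinearIndependent F s} ×
    {t : Fin d → U.1 // LinearIndependent F ((W U).mkQ ∘ t)}
  have hT (U : G) : (Nat.card (T U) : ℝ) = indepCount (Fintype.card F) i i *
          ((Fintype.card F : ℝ) ^ (i * d) * indepCount (Fintype.card F) d d) := by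
    rw [Nat.card_prod, Nat.cast_mul, card_linearIndependent_eq, card_linearIndependent_mkQ, hW,
      U.2.1, Nat.add_sub_cancel_left]
  let φ (U : G) : (U.1 ⧸ W U) →ₗ[F] V ⧸ E := (W U).mapQ E U.1.subtype le_rfl
  have hφ (U : G) : LinearMap.ker (φ U) = ⊥ := by
    rw [Submodule.ker_mapQ]
    simp [W, Submodule.mkQ_map_self]
  let Φ : (Σ U : G, T U) → {s : Fin i → E // LinearIndependent F s} ×
      {t : Fin d → V // LinearIndependent F (E.mkQ ∘ t)} := fun p =>
    ⟨⟨fun a => ⟨(p.2.1.1 a : p.1.1), (p.2.1.1 a).2⟩,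
      LinearIndependent.of_comp E.subtype
        ((p.2.1.2.map' (W p.1).subtype (W p.1).ker_subtype).map' p.1.1.subtype
          p.1.1.ker_subtype)⟩,
     ⟨fun a => p.2.2.1 a, p.2.2.2.map' (φ p.1) (hφ p.1)⟩⟩
  have hspan (p : Σ U : G, T U) : p.1.1 = Submodule.span F
      (Set.range (fun a => ((Φ p).1.1 a : V))) ⊔ Submodule.span F (Set.range (Φ p).2.1) := by
    obtain ⟨U, s, t⟩ := p
    have hs := span_range_eq_of_linearIndependent (U := (⊤ : Submodule F (W U)))
      (by rw [finrank_top, hW]) s.2 (fun _ => trivial)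
    have : Finite (U.1 ⧸ W U) := Finite.of_surjective _ (W U).mkQ_surjective
    have ht := span_range_eq_of_linearIndependent (U := (⊤ : Submodule F (U.1 ⧸ W U))) (d := d)
      (by
        rw [finrank_top]
        have := (W U).finrank_quotient_add_finrank
        rw [hW, U.2.1] at this; omega) t.2 (fun _ => trivial)
    rw [Set.range_comp, ← Submodule.map_span, Submodule.map_mkQ_eq_top] at ht
    have hs' := congrArg (Submodule.map (W U).subtype) hs
    rw [Submodule.map_subtype_top, Submodule.map_span, ← Set.range_comp] at hs'
    have hsW := congrArg (Submodule.map U.1.subtype) hs'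
    rw [Submodule.map_span, ← Set.range_comp] at hsW
    have h := congrArg (Submodule.map U.1.subtype) ht
    rw [Submodule.map_sup, ← hsW, Submodule.map_span, ← Set.range_comp,
      Submodule.map_subtype_top] at h
    exact h.symm
  have hinj : Function.Injective Φ := by
    intro p p' h
    have h1 : p.1 = p'.1 := Subtype.ext (by rw [hspan p, hspan p', h])
    obtain ⟨U, s, t⟩ := p
    obtain ⟨U', s', t'⟩ := p'
    obtain rfl : U = U' := h1
    congr 2
    · ext a
      exact congrArg (fun z => ((z.1.1 a : E) : V)) h
    · ext a
      exact congrArg (fun z => (z.2.1 a : V)) h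
  have := Fintype.ofFinite G
  have := Nat.card_le_card_of_injective Φ hinj
  rw [Nat.card_sigma, Nat.card_prod] at this
  rw [← card_linearIndependent_eq, ← card_linearIndependent_mkQ]
  have hle := (Nat.cast_le (α := ℝ)).2 this
  rw [Nat.cast_sum, Nat.cast_mul] at hle
  refine le_trans (le_of_eq ?_) hle
  simp_rw [hT]
  simp [G, Nat.card_eq_fintype_card]

end

/-! ### Vectors of given rank -/

section

variable {F L : Type*} [Field F] [Fintype F] [Field L] [Fintype L] [Algebra F L]

omit [Fintype F] [Fintype L] in
theorem span_range_linearCombination {n j : ℕ} (a : Fin j → L) (B : Matrix (Fin j) (Fin n) F) :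
    Submodule.span F (Set.range fun c => Fintype.linearCombination F a (B.col c)) =
      (Submodule.span F (Set.range B.col)).map (Fintype.linearCombination F a) := by
  rw [Submodule.map_span, ← Set.range_comp]; rfl

omit [Fintype F] [Fintype L] in
theorem rankWeight_linearCombination {n j : ℕ} {a : Fin j → L} (ha : LinearIndependent F a)
    (B : Matrix (Fin j) (Fin n) F) :
    rankWeight F (fun c => Fintype.linearCombination F a (B.col c)) = B.rank := by
  rw [rankWeight, span_range_linearCombination, Matrix.rank_eq_finrank_span_cols]
  exact (Submodule.equivMapOfInjective _ ha.fintypeLinearCombination_injective _).finrank_eq.symm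

omit [Fintype F] in
theorem linearIndependent_row_iff_rank {n j : ℕ} (B : Matrix (Fin j) (Fin n) F) :
    LinearIndependent F B.row ↔ B.rank = j := by
  rw [linearIndependent_iff_card_eq_finrank_span, Matrix.rank_eq_finrank_span_row,
    Fintype.card_fin, eq_comm]; rfl

/-- Rank factorisation: `x = a B` with `a` independent and `B` of full row rank. In the fibre over
`x`, `a` ranges over the ordered bases of the span of the entries, and `a` determines `B`. -/
theorem card_rankWeight_mul (n j : ℕ) :
    (Nat.card {x : Fin n → L // rankWeight F x = j} : ℝ) * indepCount (Fintype.card F) j j =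
      indepCount (Fintype.card F) (finrank F L) j * indepCount (Fintype.card F) n j := by
  rw [← card_linearIndependent_eq (V := L)]
  have hn := card_linearIndependent_eq (F := F) (V := Fin n → F) j
  rw [finrank_fin_fun] at hn
  rw [← hn, ← Nat.cast_mul, ← Nat.card_prod]
  let f : {a : Fin j → L // LinearIndependent F a} ×
      {B : Fin j → Fin n → F // LinearIndependent F B} → {x : Fin n → L // rankWeight F x = j} :=
    fun p => ⟨fun c => Fintype.linearCombination F p.1.1 ((Matrix.of p.2.1).col c), by
      rw [rankWeight_linearCombination p.1.2]
      exact (linearIndependent_row_iff_rank (Matrix.of p.2.1)).1 p.2.2⟩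
  have hcard (x : {x : Fin n → L // rankWeight F x = j}) :
      (Nat.card {p // f p = x} : ℝ) = indepCount (Fintype.card F) j j := by
    have hx : finrank F (Submodule.span F (Set.range x.1)) = j := x.2
    rw [← congrArg (fun t => indepCount _ t j) hx, ← card_linearIndependent_eq,
      Nat.card_congr (indepTupleEquiv _ j)]
    congr 1
    have hmem (p : {p // f p = x}) (i : Fin j) :
        p.1.1.1 i ∈ Submodule.span F (Set.range x.1) := by
      have hle : Submodule.span F (Set.range x.1) ≤ Submodule.span F (Set.range p.1.1.1) := by
        rw [Submodule.span_le, Set.range_subset_iff]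
        intro c
        rw [← congrFun (congrArg Subtype.val p.2) c, ← Fintype.range_linearCombination]
        exact ⟨_, rfl⟩
      rw [Submodule.eq_of_le_of_finrank_eq hle
        (by rw [hx, finrank_span_eq_card p.1.1.2, Fintype.card_fin])]
      exact Submodule.subset_span ⟨i, rfl⟩
    refine Nat.card_congr (Equiv.ofBijective (fun p => ⟨p.1.1.1, p.1.1.2, hmem p⟩) ⟨?_, ?_⟩)
    · intro p p' h
      have ha : p.1.1 = p'.1.1 := Subtype.ext (congrArg (fun z => z.1) h)
      refine Subtype.ext (Prod.ext ha (Subtype.ext ?_))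
      funext i c
      have h1 := congrFun (congrArg Subtype.val (p.2.trans p'.2.symm)) c
      simp only [f, ha] at h1
      exact congrFun (p'.1.1.2.fintypeLinearCombination_injective h1) i
    · rintro ⟨a, ha, hax⟩
      have hspan := span_range_eq_of_linearIndependent hx ha hax
      have hex (c : Fin n) : ∃ b : Fin j → F, Fintype.linearCombination F a b = x.1 c := by
        have : x.1 c ∈ Submodule.span F (Set.range a) := by
          rw [hspan]; exact Submodule.subset_span ⟨c, rfl⟩
        rwa [← Fintype.range_linearCombination] at this
      choose b hb using hex
      have hrow : LinearIndependent F (fun i c => b c i) := by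
        refine (linearIndependent_row_iff_rank (Matrix.of fun i c => b c i)).2 ?_
        rw [← rankWeight_linearCombination ha]
        exact (congrArg (rankWeight F) (funext hb)).trans x.2
      exact ⟨⟨⟨⟨a, ha⟩, ⟨_, hrow⟩⟩, Subtype.ext (funext hb)⟩, rfl⟩
  by_cases he : Nonempty {x : Fin n → L // rankWeight F x = j}
  · obtain ⟨x₀⟩ := he
    rw [card_eq_mul_of_fiber f (Nat.card {p // f p = x₀})
      (fun b => by exact_mod_cast (hcard b).trans (hcard x₀).symm)]
    push_cast; rw [hcard]
  · have h1 : IsEmpty {x : Fin n → L // rankWeight F x = j} := not_nonempty_iff.1 he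
    have h2 := Function.isEmpty f
    rw [Nat.card_of_isEmpty, Nat.card_of_isEmpty]; simp

/-! ### The size of a Gabidulin code -/

omit [Fintype L] in
-- A relation between the rows is a `q`-polynomial of degree below `q ^ n`. It is `F`-linear and
-- kills every `g c`, hence vanishes at the `q ^ n` points of their span and is zero.
theorem linearIndependent_gabGenerator_row {n k : ℕ} {g : Fin n → L} (hg : LinearIndependent F g)
    (hn : 0 < n) (hk : k ≤ n) : LinearIndependent L (gabGenerator F k g).row := by
  classical
  rw [Fintype.linearIndependent_iff]
  intro a ha
  have hq : 1 < Fintype.card F := Fintype.one_lt_card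
  let T : L →ₗ[F] L := ∑ i : Fin k, a i • (FiniteField.frobeniusAlgHom F L ^ (i : ℕ)).toLinearMap
  have hT (y : L) : T y = ∑ i : Fin k, a i * y ^ Fintype.card F ^ (i : ℕ) := by
    simp [T, AlgHom.coe_pow, FiniteField.coe_frobeniusAlgHom, pow_iterate]
  let P : Polynomial L := ∑ i : Fin k, Polynomial.monomial (Fintype.card F ^ (i : ℕ)) (a i)
  have hP (y : L) : P.eval y = T y := by
    simp [P, hT, Polynomial.eval_finsetSum]
  have hTg (c : Fin n) : T (g c) = 0 := by
    have := congrFun ha c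
    simpa [hT, gabGenerator, Matrix.row] using this
  have hTS (b : Fin n → F) : T (Fintype.linearCombination F g b) = 0 := by
    simp [Fintype.linearCombination_apply, hTg]
  have hdeg : P.natDegree < Fintype.card F ^ n := by
    refine lt_of_le_of_lt (Polynomial.natDegree_sum_le_of_forall_le (n := Fintype.card F ^ (n - 1))
      _ _ fun i _ => ?_) ?_
    · exact (Polynomial.natDegree_monomial_le _).trans
        (Nat.pow_le_pow_right hq.le (by have := i.2; omega))
    · exact Nat.pow_lt_pow_right hq (by omega)
  have hP0 : P = 0 := by
    refine Polynomial.eq_zero_of_natDegree_lt_card_of_eval_eq_zero P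
      hg.fintypeLinearCombination_injective (fun b => by rw [hP, hTS]) ?_
    simpa using hdeg
  intro i
  have := congrArg (fun p => p.coeff (Fintype.card F ^ (i : ℕ))) hP0
  simpa [P, Polynomial.finsetSum_coeff, Polynomial.coeff_monomial,
    (Nat.pow_right_injective hq).eq_iff, Fin.val_inj] using this

theorem card_gabCode {n k : ℕ} {g : Fin n → L} (hg : LinearIndependent F g) (hn : 0 < n)
    (hk : k ≤ n) :
    (Nat.card (gabCode F k g) : ℝ) = (Fintype.card F : ℝ) ^ (finrank F L * k) := by
  rw [gabCode, card_real_eq_pow_finrank,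
    finrank_span_eq_card (linearIndependent_gabGenerator_row hg hn hk), Fintype.card_fin,
    card_eq_pow_finrank (K := F) (V := L)]
  push_cast
  rw [pow_mul]

end

/-! ### Row spaces, correctable guesses and the union bound -/

section

variable {F L : Type*} [Field F] [Fintype F] [Field L] [Fintype L] [Algebra F L]

/-- Evaluation of a linear functional at the entries of `x`. -/
def dualEval (F : Type*) {L : Type*} [Field F] [Field L] [Algebra F L] {n : ℕ} (x : Fin n → L) :
    Dual F L →ₗ[F] Fin n → F :=
  LinearMap.pi fun c => Dual.eval F L (x c)

/-- The row space over `F` of a vector over `L`. -/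
def rowSpace (F : Type*) {L : Type*} [Field F] [Field L] [Algebra F L] {n : ℕ} (x : Fin n → L) :
    Submodule F (Fin n → F) :=
  LinearMap.range (dualEval F x)

omit [Fintype F] in
-- Row rank equals column rank: the kernel of `dualEval F x` is the annihilator of the span of the
-- entries.
theorem finrank_rowSpace {n : ℕ} (x : Fin n → L) :
    finrank F (rowSpace F x) = rankWeight F x := by
  have hker : LinearMap.ker (dualEval F x) =
      (Submodule.span F (Set.range x)).dualAnnihilator := by
    ext φ
    rw [LinearMap.mem_ker, Submodule.mem_dualAnnihilator]
    constructor
    · intro h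
      have : Submodule.span F (Set.range x) ≤ LinearMap.ker φ := by
        rw [Submodule.span_le, Set.range_subset_iff]
        exact fun c => congrFun h c
      exact fun w hw => this hw
    · exact fun h => funext fun c => h _ (Submodule.subset_span ⟨c, rfl⟩)
  have h1 := LinearMap.finrank_range_add_finrank_ker (dualEval F x)
  rw [hker, Subspace.dual_finrank_eq] at h1
  have h2 := Subspace.finrank_add_finrank_dualAnnihilator_eq (Submodule.span F (Set.range x))
  rw [rowSpace, rankWeight]
  omega

omit [Fintype F] in
-- The row space `E` of the error lies in `U` plus a space of dimension at most `t`, so `dim (U ⊔ E)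
-- ≤ δ + t`. The dimension formula gives `rank ≤ t + dim (U ⊓ E)`, and `2t ≤ n - k - δ`.
theorem Correctable.le_finrank_inf {n δ k : ℕ} {r c : Fin n → L} {B : Matrix (Fin δ) (Fin n) F}
    (h : Correctable F k r B c) {U : Submodule F (Fin n → F)} (hU : finrank F U = δ)
    (hB : ∀ i, B i ∈ U) :
    2 * rankWeight F (r - c) + δ + k ≤
      n + 2 * finrank F (U ⊓ rowSpace F (r - c) : Submodule F (Fin n → F)) := by
  obtain ⟨t, ht, aC, aE, BE, he⟩ := h
  have hle : rowSpace F (r - c) ≤ U ⊔ Submodule.span F (Set.range BE) := by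
    rintro _ ⟨φ, rfl⟩
    have : dualEval F (r - c) φ = ∑ i, φ (aC i) • B i + ∑ i, φ (aE i) • BE i := by
      funext l
      have : (r - c) l = ∑ i, B i l • aC i + ∑ i, BE i l • aE i := by
        rw [he]
        simp [Matrix.vecMul, dotProduct, Algebra.smul_def, mul_comm]
      simp only [dualEval, LinearMap.pi_apply, this, map_add, map_sum, map_smul]
      simp [mul_comm]
    rw [this]
    exact Submodule.add_mem_sup (Submodule.sum_mem _ fun i _ => U.smul_mem _ (hB i))
      (Submodule.sum_mem _ fun i _ => Submodule.smul_mem _ _ (Submodule.subset_span ⟨i, rfl⟩))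
  have h1 : finrank F (Submodule.span F (Set.range BE)) ≤ t := by
    exact (finrank_range_le_card (R := F) BE).trans_eq (Fintype.card_fin t)
  have h2 := Submodule.finrank_mono (sup_le le_sup_left hle : U ⊔ rowSpace F (r - c) ≤ _)
  have h3 := Submodule.finrank_sup_add_finrank_inf_eq U (rowSpace F (r - c))
  have h4 := Submodule.finrank_add_le_finrank_add_finrank U (Submodule.span F (Set.range BE))
  rw [finrank_rowSpace] at h3
  omega

omit [Fintype F] [Fintype L] in
theorem basisMatrix_mem {n δ : ℕ} (U : Grass F n δ) (i : Fin δ) : basisMatrix U i ∈ U.1 :=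
  (Module.finBasisOfFinrankEq F U.1 U.2 i).2

theorem gaussBinom_eq_div (q n k : ℕ) : gaussBinom q n k = indepCount q n k / indepCount q k k :=
  Finset.prod_div_distrib _ _

theorem card_grass (n δ : ℕ) : (Nat.card (Grass F n δ) : ℝ) = gaussBinom (Fintype.card F) n δ := by
  rw [gaussBinom_eq_div, eq_div_iff (indepCount_pos Fintype.one_lt_card le_rfl).ne',
    card_subspaces_mul, finrank_fin_fun]

theorem card_grass_inf_le {n δ i : ℕ} (E : Submodule F (Fin n → F)) (hi : i ≤ δ)
    (hiE : i ≤ finrank F E) :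
    (Nat.card {U : Grass F n δ // finrank F (U.1 ⊓ E : Submodule F (Fin n → F)) = i} : ℝ) ≤
      gaussBinom (Fintype.card F) (n - finrank F E) (δ - i) *
        gaussBinom (Fintype.card F) (finrank F E) i *
          (Fintype.card F : ℝ) ^ ((finrank F E - i) * (δ - i)) := by
  obtain ⟨d, rfl⟩ := Nat.exists_eq_add_of_le hi
  obtain ⟨l, hl⟩ := Nat.exists_eq_add_of_le hiE
  have h := card_subspaces_inf_mul_le E i d
  rw [finrank_fin_fun] at h
  rw [hl] at h ⊢
  rw [Nat.add_sub_cancel_left, Nat.add_sub_cancel_left, gaussBinom_eq_div, gaussBinom_eq_div]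
  have hi0 := indepCount_pos (q := Fintype.card F) Fintype.one_lt_card (le_refl i)
  have hd0 := indepCount_pos (q := Fintype.card F) Fintype.one_lt_card (le_refl d)
  have hq : (0 : ℝ) < (Fintype.card F : ℝ) ^ (i * d) := by
    have := Fintype.card_pos (α := F); positivity
  rw [Nat.card_congr (Equiv.subtypeSubtypeEquivSubtypeInter
    (fun U : Submodule F (Fin n → F) => finrank F U = i + d)
    (fun U => finrank F (U ⊓ E : Submodule F (Fin n → F)) = i)),
    ← mul_le_mul_iff_left₀ (mul_pos hi0 (mul_pos hq hd0))]
  refine h.trans (le_of_eq ?_)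
  rw [add_mul, pow_add]
  field_simp

/-- Correctability depends only on `r - c`, so codeword `0` covers all cases. The guesses are sorted
by their intersection dimension with the row space of `e`; when `guessProb` is 1 the bound is
trivial. -/
theorem card_correctable_le {n δ k : ℕ} (hδ : δ + k ≤ n) (e : Fin n → L) :
    (Nat.card {U : Grass F n δ // Correctable F k e (basisMatrix U) 0} : ℝ) ≤
      guessProb (Fintype.card F) n k δ (rankWeight F e) * Nat.card (Grass F n δ) := by
  rw [guessProb]
  split_ifs with h
  · rw [card_grass, div_mul_cancel₀]
    swap
    · rw [gaussBinom_eq_div]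
      exact (div_pos (indepCount_pos Fintype.one_lt_card (by omega))
        (indepCount_pos Fintype.one_lt_card le_rfl)).ne'
    rw [← finrank_rowSpace] at h ⊢
    set j := finrank F (rowSpace F e) with hj
    let f (U : {U : Grass F n δ // Correctable F k e (basisMatrix U) 0}) : ℕ :=
      finrank F (U.1.1 ⊓ rowSpace F e : Submodule F (Fin n → F))
    have hf (U) : f U ∈ Finset.Icc ⌈(j : ℝ) - ((n : ℝ) - k) / 2 + (δ : ℝ) / 2⌉₊ (min δ j) := by
      rw [Finset.mem_Icc, le_min_iff, Nat.ceil_le]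
      refine ⟨?_, ?_, Submodule.finrank_mono inf_le_right⟩
      · have := U.2.le_finrank_inf U.1.2 (basisMatrix_mem U.1)
        rw [sub_zero, ← finrank_rowSpace] at this
        have : (2 * j + δ + k : ℝ) ≤ n + 2 * f U := by exact_mod_cast this
        linarith
      · exact (Submodule.finrank_mono inf_le_left).trans_eq U.1.2
    have := Fintype.ofFinite {U : Grass F n δ // Correctable F k e (basisMatrix U) 0}
    rw [Nat.card_eq_fintype_card, Fintype.card, Finset.card_eq_sum_card_fiberwise
      (fun U _ => hf U), Nat.cast_sum]
    refine Finset.sum_le_sum fun i hi => ?_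
    rw [Finset.mem_Icc, le_min_iff] at hi
    refine le_trans ?_ (card_grass_inf_le (rowSpace F e) hi.2.1 hi.2.2)
    rw [← Fintype.card_subtype, ← Nat.card_eq_fintype_card]
    refine Nat.cast_le.2 (Nat.card_le_card_of_injective (fun U => ⟨U.1.1, U.2⟩) ?_)
    intro U U' hUU
    exact Subtype.ext (Subtype.ext (Subtype.mk.inj hUU))
  · rw [one_mul]
    exact Nat.cast_le.2 (Nat.card_le_card_of_injective _ Subtype.val_injective)

theorem Abar_eq {n k : ℕ} {g : Fin n → L} (hg : LinearIndependent F g) (hn : 0 < n) (hk : k ≤ n)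
    (j : ℕ) :
    Abar (Fintype.card F) (finrank F L) n k j =
      Nat.card (gabCode F k g) * Nat.card {x : Fin n → L // rankWeight F x = j} /
        Nat.card (Fin n → L) := by
  have hj := indepCount_pos (q := Fintype.card F) Fintype.one_lt_card (le_refl j)
  have hq : (0 : ℝ) < Fintype.card F := by exact_mod_cast Fintype.card_pos
  rw [eq_div_of_mul_eq hj.ne' (card_rankWeight_mul (F := F) (L := L) n j), card_gabCode hg hn hk,
    Nat.card_fun, Nat.card_fin, Nat.card_eq_fintype_card (α := L),
    card_eq_pow_finrank (K := F) (V := L), Abar, Finset.prod_div_distrib,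
    Finset.prod_mul_distrib, mul_sub, zpow_sub₀ hq.ne', ← Nat.cast_mul, ← Nat.cast_mul,
    zpow_natCast, zpow_natCast]
  push_cast
  rw [← pow_mul]
  simp only [indepCount]
  field_simp

/-- The pairs `(r, c)` correspond bijectively to the pairs `(c, r - c)`. -/
theorem averageCodewords_eq {n k : ℕ} {g : Fin n → L} (hg : LinearIndependent F g) (hn : 0 < n)
    (hk : k ≤ n) (j : ℕ) :
    averageCodewords F k g j = Abar (Fintype.card F) (finrank F L) n k j := by
  classical
  rw [Abar_eq hg hn hk, averageCodewords, Finset.expect_eq_sum_div_card, Finset.card_univ,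
    ← Nat.card_eq_fintype_card (α := Fin n → L)]
  congr 1
  simp_rw [← Nat.card_coe_set_eq]
  rw [← Nat.cast_sum, ← Nat.cast_mul, ← Nat.card_sigma, ← Nat.card_prod]
  congr 1
  refine Nat.card_congr (Equiv.ofBijective
    (fun p => ⟨⟨p.2.1, p.2.2.1⟩, ⟨p.1 - p.2.1, p.2.2.2⟩⟩) ⟨?_, ?_⟩)
  · rintro ⟨r, c, h⟩ ⟨r', c', h'⟩ hrc
    obtain rfl : c = c' := congrArg (fun z => z.1.1) hrc
    obtain rfl : r = r' := sub_left_injective (congrArg (fun z => z.2.1) hrc)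
    rfl
  · rintro ⟨⟨c, hc⟩, ⟨e, he⟩⟩
    exact ⟨⟨e + c, c, hc, by rwa [add_sub_cancel_right]⟩, by simp⟩

theorem uniformProb_eq (Ω : Type*) [Finite Ω] (E : Set Ω) :
    uniformProb Ω E = Nat.card E / Nat.card Ω := by
  have := Fintype.ofFinite Ω
  let _ : MeasurableSpace Ω := ⊤
  rw [uniformProb, MeasureTheory.measureReal_def, ProbabilityTheory.uniformOn_univ,
    MeasureTheory.Measure.count_apply_finite _ E.toFinite]
  simp [← Set.ncard_eq_toFinset_card E]

theorem uniformProb_successEvent_le {n k δ : ℕ} (w : ℕ) {g : Fin n → L}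
    (hg : LinearIndependent F g) (hn : 0 < n) (hδ : δ + k ≤ n) :
    uniformProb ((Fin n → L) × Grass F n δ) (successEvent F k δ w g) ≤
      ∑ j ∈ Finset.range (w + 1),
        Abar (Fintype.card F) (finrank F L) n k j * guessProb (Fintype.card F) n k δ j := by
  classical
  -- The union bound as an injection: success on `(r, U)` yields `(j, c, e, U)`, from which `r = c +
  -- e`. Uniqueness of the decoded codeword plays no role.
  let S := Σ j : Fin (w + 1), gabCode F k g × Σ e : {e : Fin n → L // rankWeight F e = j},
    {U : Grass F n δ // Correctable F k e.1 (basisMatrix U) 0}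
  have hex (x : successEvent F k δ w g) : ∃ s : S, s.2.1.1 + s.2.2.1.1 = x.1.1 ∧
      s.2.2.2.1 = x.1.2 := by
    obtain ⟨⟨r, U⟩, c, hdec, hw⟩ := x
    rw [errorErasureDecode] at hdec
    split_ifs at hdec with h
    obtain ⟨hc, hcorr⟩ := h.choose_spec
    rw [Option.some.inj hdec] at hc hcorr
    refine ⟨⟨⟨rankWeight F (r - c), Nat.lt_succ_of_le hw⟩, ⟨c, hc⟩, ⟨r - c, rfl⟩, U, ?_⟩,
      add_sub_cancel _ _, rfl⟩
    simpa [Correctable] using hcorr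
  choose s hs using hex
  have hinj : Function.Injective s := by
    intro x y h
    refine Subtype.ext (Prod.ext ?_ ?_)
    · rw [← (hs x).1, ← (hs y).1, h]
    · rw [← (hs x).2, ← (hs y).2, h]
  have hcard := Nat.cast_le (α := ℝ).2 (Nat.card_le_card_of_injective s hinj)
  have hG : (0 : ℝ) < Nat.card (Grass F n δ) := by
    rw [card_grass, gaussBinom_eq_div]
    exact div_pos (indepCount_pos Fintype.one_lt_card (by omega))
      (indepCount_pos Fintype.one_lt_card le_rfl)
  have hL : (0 : ℝ) < Nat.card (Fin n → L) := by exact_mod_cast Nat.card_pos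
  rw [uniformProb_eq, Nat.card_prod, Nat.cast_mul, div_le_iff₀ (by positivity)]
  refine hcard.trans ?_
  rw [Nat.card_sigma, Nat.cast_sum, Finset.sum_mul, ← Fin.sum_univ_eq_sum_range (fun j =>
    Abar (Fintype.card F) (finrank F L) n k j * guessProb (Fintype.card F) n k δ j *
      ((Nat.card (Fin n → L) : ℝ) * Nat.card (Grass F n δ)))]
  refine Finset.sum_le_sum fun j _ => ?_
  rw [Nat.card_prod, Nat.card_sigma, Abar_eq hg hn (by omega)]
  push_cast
  have hsum : ∑ e : {e : Fin n → L // rankWeight F e = j},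
      (Nat.card {U : Grass F n δ // Correctable F k e.1 (basisMatrix U) 0} : ℝ) ≤
      Nat.card {e : Fin n → L // rankWeight F e = j} *
        (guessProb (Fintype.card F) n k δ j * Nat.card (Grass F n δ)) := by
    refine (Finset.sum_le_sum fun e _ => card_correctable_le hδ e.1).trans (le_of_eq ?_)
    rw [Finset.sum_congr rfl fun e _ => by rw [e.2]]
    simp [Nat.card_eq_fintype_card]
  refine (mul_le_mul_of_nonneg_left hsum (Nat.cast_nonneg _)).trans (le_of_eq ?_)
  field_simp

end

/-! ### Estimates -/

theorem prod_one_sub_pow_ge {x : ℝ} (hx0 : 0 ≤ x) (hx : x ≤ 1 / 2) (k : ℕ) :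
    9 / 32 ≤ ∏ i ∈ Finset.range k, (1 - x ^ (i + 1)) := by
  -- The extra `(1/2) ^ (k + 2)` is the slack that lets the induction close. It needs this power to
  -- be at most 1/4, hence the start at two factors, whose product is at least 3/8; and 9/32 = 3/8 ·
  -- 3/4.
  have key (k : ℕ) : 3 / 8 * (3 / 4 + (1 / 2 : ℝ) ^ (k + 2)) ≤
      ∏ i ∈ Finset.range (k + 2), (1 - x ^ (i + 1)) := by
    induction k with
    | zero =>
      simp only [Finset.prod_range_succ, Finset.prod_range_zero]
      norm_num
      nlinarith [mul_nonneg hx0 hx0, mul_nonneg (sub_nonneg.2 hx) (mul_nonneg hx0 hx0),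
        mul_nonneg (sub_nonneg.2 hx) hx0]
    | succ k ih =>
      rw [Finset.prod_range_succ]
      have h1 : x ^ (k + 2 + 1) ≤ (1 / 2 : ℝ) ^ (k + 2) / 2 := by
        calc x ^ (k + 2 + 1) ≤ (1 / 2 : ℝ) ^ (k + 2 + 1) := pow_le_pow_left₀ hx0 hx _
          _ = _ := by rw [pow_succ]; ring
      have h2 : (1 / 2 : ℝ) ^ (k + 2) ≤ 1 / 4 := by
        calc (1 / 2 : ℝ) ^ (k + 2) ≤ (1 / 2 : ℝ) ^ 2 :=
              pow_le_pow_of_le_one (by norm_num) (by norm_num) (by omega)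
          _ = 1 / 4 := by norm_num
      have h3 : (1 / 2 : ℝ) ^ (k + 1 + 2) = (1 / 2 : ℝ) ^ (k + 2) / 2 := by
        rw [show k + 1 + 2 = k + 2 + 1 by ring, pow_succ]; ring
      have h0 : (0 : ℝ) < (1 / 2 : ℝ) ^ (k + 2) := by positivity
      rw [h3]
      set t := (1 / 2 : ℝ) ^ (k + 2)
      calc 3 / 8 * (3 / 4 + t / 2) ≤ 3 / 8 * (3 / 4 + t) * (1 - t / 2) := by
            nlinarith [mul_nonneg h0.le (sub_nonneg.2 h2)]
        _ ≤ _ := mul_le_mul ih (by linarith) (by linarith) (le_trans (by positivity) ih)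
  match k with
  | 0 => norm_num
  | 1 => norm_num; linarith
  | k + 2 => exact le_trans (by have : (0 : ℝ) < (1 / 2 : ℝ) ^ (k + 2) := by positivity
                                linarith) (key k)

section

variable {q : ℕ}

theorem indepCount_le (hq : 1 < q) {n k : ℕ} (hk : k ≤ n) :
    indepCount q n k ≤ (q : ℝ) ^ (n * k) := by
  have hq' : (1 : ℝ) ≤ q := by exact_mod_cast hq.le
  rw [pow_mul]
  refine (Finset.prod_le_prod (s := Finset.range k) (g := fun _ => (q : ℝ) ^ n)
    (fun i hi => ?_) fun i hi => ?_).trans_eq (by simp)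
  · exact sub_nonneg.2 (pow_le_pow_right₀ hq' (by have := Finset.mem_range.1 hi; omega))
  · have : (0 : ℝ) ≤ (q : ℝ) ^ i := by positivity
    linarith

theorem indepCount_self_ge (hq : 1 < q) (k : ℕ) :
    9 / 32 * (q : ℝ) ^ (k * k) ≤ indepCount q k k := by
  have hq2 : (2 : ℝ) ≤ q := by exact_mod_cast hq
  have hq0 : (0 : ℝ) < q := by linarith
  have hprod : indepCount q k k =
      (∏ i ∈ Finset.range k, (1 - ((q : ℝ)⁻¹) ^ (i + 1))) * (q : ℝ) ^ (k * k) := by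
    rw [indepCount, ← Finset.prod_range_reflect (fun i => 1 - ((q : ℝ)⁻¹) ^ (i + 1)), pow_mul,
      show ((q : ℝ) ^ k) ^ k = ∏ _i ∈ Finset.range k, (q : ℝ) ^ k by simp,
      ← Finset.prod_mul_distrib]
    refine Finset.prod_congr rfl fun i hi => ?_
    have hi := Finset.mem_range.1 hi
    rw [sub_mul, one_mul, inv_pow, show k - 1 - i + 1 = k - i by omega]
    congr 1
    rw [eq_inv_mul_iff_mul_eq₀ (by positivity), ← pow_add]
    congr 1; omega
  rw [hprod]
  refine mul_le_mul_of_nonneg_right (prod_one_sub_pow_ge (by positivity) ?_ k) (by positivity)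
  rw [one_div]
  exact inv_anti₀ (by norm_num) hq2

theorem gaussBinom_pos (hq : 1 < q) {n k : ℕ} (hk : k ≤ n) : 0 < gaussBinom q n k := by
  rw [gaussBinom_eq_div]
  exact div_pos (indepCount_pos hq hk) (indepCount_pos hq le_rfl)

theorem gaussBinom_le (hq : 1 < q) {n k : ℕ} (hk : k ≤ n) :
    gaussBinom q n k ≤ 32 / 9 * (q : ℝ) ^ (k * (n - k)) := by
  rw [gaussBinom_eq_div, div_le_iff₀ (indepCount_pos hq le_rfl)]
  refine (indepCount_le hq hk).trans ?_
  have h := mul_le_mul_of_nonneg_left (indepCount_self_ge hq k)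
    (by positivity : (0 : ℝ) ≤ 32 / 9 * (q : ℝ) ^ (k * (n - k)))
  refine le_trans (le_of_eq ?_) h
  obtain ⟨d, rfl⟩ := Nat.exists_eq_add_of_le hk
  rw [Nat.add_sub_cancel_left, add_mul, pow_add, mul_comm d k]
  ring

theorem gaussBinom_ge (hq : 1 < q) {n k : ℕ} (hk : k ≤ n) :
    (q : ℝ) ^ (k * (n - k)) ≤ gaussBinom q n k := by
  have hq' : (1 : ℝ) < q := by exact_mod_cast hq
  rw [mul_comm, pow_mul, gaussBinom]
  refine le_trans (le_of_eq ?_) (Finset.prod_le_prod (s := Finset.range k)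
    (f := fun _ => (q : ℝ) ^ (n - k)) (fun i _ => by positivity) fun i hi => ?_)
  · simp
  · have hi := Finset.mem_range.1 hi
    rw [le_div_iff₀ (sub_pos.2 (pow_lt_pow_right₀ hq' hi)), mul_sub, ← pow_add,
      Nat.sub_add_cancel hk, ← pow_add]
    exact sub_le_sub_left (pow_le_pow_right₀ hq'.le (by omega)) _

theorem Abar_nonneg (hq : 1 < q) {m n k j : ℕ} (hjm : j ≤ m) (hjn : j ≤ n) :
    0 ≤ Abar q m n k j := by
  refine mul_nonneg (by positivity) (Finset.prod_nonneg fun i hi => ?_)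
  have hi := Finset.mem_range.1 hi
  have hq' : (1 : ℝ) ≤ q := by exact_mod_cast hq.le
  have h {a : ℕ} (ha : j ≤ a) : (0 : ℝ) ≤ (q : ℝ) ^ a - (q : ℝ) ^ i :=
    sub_nonneg.2 (pow_le_pow_right₀ hq' (by omega))
  exact div_nonneg (mul_nonneg (h hjm) (h hjn)) (h le_rfl)

theorem Abar_le (hq : 1 < q) {m n k j : ℕ} (hjm : j ≤ m) (hjn : j ≤ n) :
    Abar q m n k j ≤
      32 / 9 * (q : ℝ) ^ ((m : ℝ) * ((k : ℝ) - n) + (j : ℝ) * ((n : ℝ) + m) - (j : ℝ) ^ 2) := by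
  have hq0 : (0 : ℝ) < q := by exact_mod_cast hq.le
  have hA : Abar q m n k j =
      (q : ℝ) ^ ((m : ℤ) * ((k : ℤ) - n)) * (indepCount q m j * gaussBinom q n j) := by
    rw [Abar, indepCount, gaussBinom, ← Finset.prod_mul_distrib]
    congr 1
    exact Finset.prod_congr rfl fun i _ => by rw [mul_div_assoc]
  have hexp : (q : ℝ) ^ ((m : ℝ) * ((k : ℝ) - n) + (j : ℝ) * ((n : ℝ) + m) - (j : ℝ) ^ 2) =
      (q : ℝ) ^ ((m : ℤ) * ((k : ℤ) - n)) * ((q : ℝ) ^ (m * j) * (q : ℝ) ^ (j * (n - j))) := by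
    rw [← Real.rpow_intCast, ← Real.rpow_natCast (q : ℝ) (m * j),
      ← Real.rpow_natCast (q : ℝ) (j * (n - j)), ← Real.rpow_add hq0,
      ← Real.rpow_add hq0]
    push_cast [Nat.cast_sub hjn]
    congr 1; ring
  rw [hA, hexp]
  calc _ ≤ (q : ℝ) ^ ((m : ℤ) * ((k : ℤ) - n)) *
        ((q : ℝ) ^ (m * j) * (32 / 9 * (q : ℝ) ^ (j * (n - j)))) := by
        refine mul_le_mul_of_nonneg_left ?_ (by positivity)
        exact mul_le_mul (indepCount_le hq hjm) (gaussBinom_le hq hjn) (gaussBinom_pos hq hjn).le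
          (by positivity)
    _ = _ := by ring

theorem gaussBinom_term_le (hq : 1 < q) {n δ i j : ℕ} (hiδ : i ≤ δ) (hij : i ≤ j) (hj : j ≤ n)
    (hδ : δ ≤ n - j + i) :
    gaussBinom q (n - j) (δ - i) * gaussBinom q j i * (q : ℝ) ^ ((j - i) * (δ - i)) ≤
      (32 / 9) ^ 2 * ((q : ℝ)⁻¹) ^ (i * (n - j + i - δ)) * gaussBinom q n δ := by
  have hq0 : (0 : ℝ) < q := by exact_mod_cast hq.le
  have hexp : (q : ℝ) ^ ((δ - i) * (n - j - (δ - i))) * (q : ℝ) ^ (i * (j - i)) *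
      (q : ℝ) ^ ((j - i) * (δ - i)) =
      ((q : ℝ)⁻¹) ^ (i * (n - j + i - δ)) * (q : ℝ) ^ (δ * (n - δ)) := by
    rw [inv_pow, eq_inv_mul_iff_mul_eq₀ (by positivity), ← pow_add, ← pow_add, ← pow_add]
    congr 1
    -- With `a = δ - i`, `b = j - i`, `e = n - j - a` the identity of exponents is `ie + ae + ib +
    -- ba = (i + a)(b + e)`.
    obtain ⟨a, rfl⟩ := Nat.exists_eq_add_of_le hiδ
    obtain ⟨b, rfl⟩ := Nat.exists_eq_add_of_le hij
    obtain ⟨c, rfl⟩ := Nat.exists_eq_add_of_le hj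
    obtain ⟨e, rfl⟩ : ∃ e, c = a + e := ⟨c - a, by omega⟩
    rw [show i + b + (a + e) - (i + b) + i - (i + a) = e by omega,
      show i + a - i = a by omega, show i + b + (a + e) - (i + b) - a = e by omega,
      show i + b - i = b by omega, show i + b + (a + e) - (i + a) = b + e by omega]
    ring
  calc _ ≤ (32 / 9 * (q : ℝ) ^ ((δ - i) * (n - j - (δ - i)))) *
        (32 / 9 * (q : ℝ) ^ (i * (j - i))) * (q : ℝ) ^ ((j - i) * (δ - i)) := by
        refine mul_le_mul_of_nonneg_right ?_ (by positivity)
        exact mul_le_mul (gaussBinom_le hq (by omega)) (gaussBinom_le hq hij)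
          (gaussBinom_pos hq hij).le (by positivity)
    _ = (32 / 9) ^ 2 * (((q : ℝ)⁻¹) ^ (i * (n - j + i - δ)) * (q : ℝ) ^ (δ * (n - δ))) := by
        rw [← hexp]; ring
    _ ≤ (32 / 9) ^ 2 * (((q : ℝ)⁻¹) ^ (i * (n - j + i - δ)) * gaussBinom q n δ) := by
        have := gaussBinom_ge hq (show δ ≤ n by omega)
        gcongr
    _ = _ := by ring

/-- Since `a, c ≥ 1`, `(a + s)(c + s) ≥ ac + 3s`; the ratio `x ^ 3 ≤ 1/8` sums to at most 8/7. -/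
theorem sum_geometric_le {x : ℝ} (hx0 : 0 ≤ x) (hx : x ≤ 1 / 2) {a c : ℕ} (ha : 1 ≤ a)
    (hc : 1 ≤ c) (N : ℕ) :
    ∑ s ∈ Finset.range N, x ^ ((a + s) * (c + s)) ≤ 8 / 7 * x ^ (a * c) := by
  have h3 : x ^ 3 ≤ 1 / 8 :=
    (pow_le_pow_left₀ hx0 hx 3).trans_eq (by norm_num)
  have hgeom : ∑ s ∈ Finset.range N, (x ^ 3) ^ s ≤ 8 / 7 := by
    refine (Summable.sum_le_tsum _ (fun _ _ => by positivity)
      (summable_geometric_of_lt_one (by positivity) (by linarith))).trans ?_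
    rw [tsum_geometric_of_lt_one (by positivity) (by linarith), inv_le_comm₀ (by linarith)
      (by norm_num)]
    linarith
  calc _ ≤ ∑ s ∈ Finset.range N, (x ^ 3) ^ s * x ^ (a * c) := by
        refine Finset.sum_le_sum fun s _ => ?_
        rw [← pow_mul, ← pow_add]
        refine pow_le_pow_of_le_one hx0 (by linarith) ?_
        nlinarith [Nat.le_mul_self s, Nat.mul_le_mul_right s ha, Nat.mul_le_mul_right s hc]
    _ ≤ _ := by
        rw [← Finset.sum_mul]
        exact mul_le_mul_of_nonneg_right hgeom (by positivity)

theorem guessProb_le_of_lt (hq : 1 < q) {n k δ j a : ℕ} (hk : 1 ≤ k) (hj : j ≤ n) (hδ : δ + k ≤ n)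
    (hlt : n < 2 * j + δ + k) (ha : a = ⌈(j : ℝ) - ((n : ℝ) - k) / 2 + (δ : ℝ) / 2⌉₊) :
    guessProb q n k δ j ≤ (32 / 9) ^ 2 * (8 / 7) * ((q : ℝ)⁻¹) ^ (a * (n - j + a - δ)) := by
  have hq2 : (2 : ℝ) ≤ q := by exact_mod_cast hq
  have ha2 : 2 * j + δ + k ≤ n + 2 * a := by
    have := Nat.le_ceil ((j : ℝ) - ((n : ℝ) - k) / 2 + (δ : ℝ) / 2)
    rw [← ha] at this
    have : (2 * j + δ + k : ℝ) ≤ n + 2 * a := by linarith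
    exact_mod_cast this
  have hx : ((q : ℝ)⁻¹) ≤ 1 / 2 := by rw [one_div]; exact inv_anti₀ (by norm_num) hq2
  rw [guessProb, if_pos hlt, ← ha, div_le_iff₀ (gaussBinom_pos hq (by omega))]
  calc _ ≤ ∑ i ∈ Finset.Icc a (min δ j),
        (32 / 9) ^ 2 * ((q : ℝ)⁻¹) ^ (i * (n - j + i - δ)) * gaussBinom q n δ := by
        refine Finset.sum_le_sum fun i hi => ?_
        rw [Finset.mem_Icc, le_min_iff] at hi
        exact gaussBinom_term_le hq hi.2.1 hi.2.2 hj (by omega)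
    _ = (32 / 9) ^ 2 * (∑ i ∈ Finset.Icc a (min δ j), ((q : ℝ)⁻¹) ^ (i * (n - j + i - δ))) *
          gaussBinom q n δ := by
        rw [← Finset.sum_mul, ← Finset.mul_sum]
    _ ≤ (32 / 9) ^ 2 * (8 / 7 * ((q : ℝ)⁻¹) ^ (a * (n - j + a - δ))) * gaussBinom q n δ := by
        have := (gaussBinom_pos hq (show δ ≤ n by omega)).le
        gcongr
        -- Both factors of the leading exponent are positive: `a ≥ 1` by `hlt`, and `2(n - j + a -
        -- δ) ≥ n + k - δ ≥ 2k`.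
        rw [← Finset.Ico_add_one_right_eq_Icc, Finset.sum_Ico_eq_sum_range]
        refine le_trans (le_of_eq (Finset.sum_congr rfl fun s _ => ?_))
          (sum_geometric_le (by positivity) hx (a := a) (c := n - j + a - δ) (by omega) (by omega) _)
        congr 2
        omega
    _ = _ := by ring

/-- One formula covers both cases: where `guessProb` is 1, the first ceiling is nonpositive and the
other factor nonnegative, so the power of `q` is at least 1. -/
theorem guessProb_le (hq : 1 < q) {n k δ j : ℕ} (hk : 1 ≤ k) (hj : j ≤ n) (hδ : δ + k ≤ n) :
    guessProb q n k δ j ≤ (32 / 9) ^ 2 * (8 / 7) *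
      (q : ℝ) ^ (-((⌈(δ : ℝ) / 2 + j - ((n : ℝ) - k) / 2⌉ : ℝ) *
            (((n : ℝ) + k) / 2 - (⌈(δ : ℝ) / 2⌉ : ℝ)))) := by
  have hq1 : (1 : ℝ) ≤ q := by exact_mod_cast hq.le
  have hδ' : (δ : ℝ) + k ≤ n := by exact_mod_cast hδ
  have hk' : (1 : ℝ) ≤ k := by exact_mod_cast hk
  by_cases hlt : n < 2 * j + δ + k
  · refine (guessProb_le_of_lt hq hk hj hδ hlt rfl).trans ?_
    have hceil : (⌈(δ : ℝ) / 2 + j - ((n : ℝ) - k) / 2⌉ : ℝ) =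
        (⌈(j : ℝ) - ((n : ℝ) - k) / 2 + (δ : ℝ) / 2⌉₊ : ℝ) := by
      have h0 : (0 : ℝ) ≤ (j : ℝ) - ((n : ℝ) - k) / 2 + (δ : ℝ) / 2 := by
        have : (n : ℝ) < 2 * j + δ + k := by exact_mod_cast hlt
        linarith
      rw [natCast_ceil_eq_intCast_ceil h0]
      congr 2; ring
    rw [hceil]
    set a := ⌈(j : ℝ) - ((n : ℝ) - k) / 2 + (δ : ℝ) / 2⌉₊ with ha
    have ha' : (j : ℝ) - ((n : ℝ) - k) / 2 + (δ : ℝ) / 2 ≤ a := Nat.le_ceil _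
    have hc : ((n : ℝ) + k) / 2 - (⌈(δ : ℝ) / 2⌉ : ℝ) ≤ ((n - j + a - δ : ℕ) : ℝ) := by
      have ha2 : 2 * j + δ + k ≤ n + 2 * a := by
        have : (2 * j + δ + k : ℝ) ≤ n + 2 * a := by linarith
        exact_mod_cast this
      rw [Nat.cast_sub (by omega), Nat.cast_add, Nat.cast_sub hj]
      have := Int.le_ceil ((δ : ℝ) / 2)
      linarith
    rw [inv_pow, ← Real.rpow_natCast (q : ℝ) (a * _), ← Real.rpow_neg (by linarith)]
    refine mul_le_mul_of_nonneg_left (Real.rpow_le_rpow_of_exponent_le hq1 (neg_le_neg ?_))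
      (by norm_num)
    rw [Nat.cast_mul]
    exact mul_le_mul_of_nonneg_left hc (Nat.cast_nonneg _)
  · rw [guessProb, if_neg hlt]
    have hz : (⌈(δ : ℝ) / 2 + j - ((n : ℝ) - k) / 2⌉ : ℝ) ≤ 0 := by
      have : (2 * j + δ + k : ℝ) ≤ n := by exact_mod_cast not_lt.1 hlt
      have : ⌈(δ : ℝ) / 2 + j - ((n : ℝ) - k) / 2⌉ ≤ 0 := by
        rw [Int.ceil_le]; push_cast; linarith
      exact_mod_cast this
    have hA : 0 ≤ ((n : ℝ) + k) / 2 - (⌈(δ : ℝ) / 2⌉ : ℝ) := by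
      have := Int.ceil_lt_add_one ((δ : ℝ) / 2)
      linarith
    have h1 := Real.one_le_rpow hq1 (neg_nonneg.2 (mul_nonpos_of_nonpos_of_nonneg hz hA))
    linarith

theorem sum_Abar_mul_guessProb_le (hq : 1 < q) {m n k w δ : ℕ} (hk : 1 ≤ k) (hnm : n ≤ m)
    (hδ : δ + k ≤ n) (hw : 2 * w + k ≤ n + δ) :
    ∑ j ∈ Finset.range (w + 1), Abar q m n k j * guessProb q n k δ j ≤
      64 * (n : ℝ) * (q : ℝ) ^
        ((m : ℝ) * ((k : ℝ) - n) + (w : ℝ) * ((n : ℝ) + m) - (w : ℝ) ^ 2 -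
          (⌈(δ : ℝ) / 2 + w - ((n : ℝ) - k) / 2⌉ : ℝ) *
            (((n : ℝ) + k) / 2 - (⌈(δ : ℝ) / 2⌉ : ℝ))) := by
  have hq1 : (1 : ℝ) ≤ q := by exact_mod_cast hq.le
  have hq0 : (0 : ℝ) < q := by linarith
  set A : ℝ := ((n : ℝ) + k) / 2 - (⌈(δ : ℝ) / 2⌉ : ℝ) with hA
  set X : ℝ := (m : ℝ) * ((k : ℝ) - n) + (w : ℝ) * ((n : ℝ) + m) - (w : ℝ) ^ 2 -
    (⌈(δ : ℝ) / 2 + w - ((n : ℝ) - k) / 2⌉ : ℝ) * A with hX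
  have hterm : ∀ j ∈ Finset.range (w + 1), Abar q m n k j * guessProb q n k δ j ≤
      64 * (q : ℝ) ^ X := by
    intro j hj
    have hjw : j ≤ w := by have := Finset.mem_range.1 hj; omega
    -- Changing `l` shifts the ceiling by an integer, so the exponents at `w` and `j` differ by
    -- exactly `(w - j)(n + m - w - j - A)`. This is nonnegative because `w + A ≤ n` and `j ≤ m`.
    have hceil (l : ℕ) : (⌈(δ : ℝ) / 2 + l - ((n : ℝ) - k) / 2⌉ : ℝ) =
        (⌈(δ : ℝ) / 2 - ((n : ℝ) - k) / 2⌉ : ℝ) + l := by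
      rw [show (δ : ℝ) / 2 + l - ((n : ℝ) - k) / 2 = (δ : ℝ) / 2 - ((n : ℝ) - k) / 2 + l by ring,
        Int.ceil_add_natCast]
      push_cast; rfl
    have h := mul_le_mul_of_nonneg (Abar_le hq (k := k) (show j ≤ m by omega)
      (show j ≤ n by omega)) (guessProb_le hq hk (show j ≤ n by omega) hδ)
      (Abar_nonneg hq (by omega) (by omega)) (by positivity)
    refine h.trans ?_
    rw [mul_mul_mul_comm, ← Real.rpow_add hq0]
    -- The constant is `(32/9)^3 · 8/7 < 64`.
    refine mul_le_mul (by norm_num) (Real.rpow_le_rpow_of_exponent_le hq1 ?_) (by positivity)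
      (by norm_num)
    rw [hX, hceil, hceil, ← hA]
    have hjw' : (j : ℝ) ≤ w := by exact_mod_cast hjw
    have hw' : (2 * w + k : ℝ) ≤ n + δ := by exact_mod_cast hw
    have hδ' : (δ : ℝ) + k ≤ n := by exact_mod_cast hδ
    have hnm' : (n : ℝ) ≤ m := by exact_mod_cast hnm
    have hk' : (1 : ℝ) ≤ k := by exact_mod_cast hk
    have hAle : A ≤ ((n : ℝ) + k) / 2 - (δ : ℝ) / 2 := by
      have := Int.le_ceil ((δ : ℝ) / 2)
      rw [hA]; linarith
    nlinarith [mul_nonneg (sub_nonneg.2 hjw')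
      (show (0 : ℝ) ≤ (n : ℝ) + m - (w + j) - A by linarith)]
  refine (Finset.sum_le_card_nsmul _ _ _ hterm).trans ?_
  rw [Finset.card_range, nsmul_eq_mul, ← mul_assoc, mul_comm _ (64 : ℝ)]
  -- `2w ≤ n + δ - k ≤ 2(n - k)` and `k ≥ 1`.
  have : ((w + 1 : ℕ) : ℝ) ≤ n := by exact_mod_cast (by omega : w + 1 ≤ n)
  gcongr

end

end GabidulinDecoding

theorem lemma3 {F L : Type*} [Field F] [Fintype F] [Field L] [Fintype L] [Algebra F L]
    (q m n k w δ : ℕ) (hq : Fintype.card F = q) (hm : Module.finrank F L = m) (hk : 1 ≤ k)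
    (g : Fin n → L) (hg : LinearIndependent F g)
    (hδ₁ : 2 * GabidulinDecoding.excess n k w ≤ (δ : ℝ)) (hδ₂ : (δ : ℝ) ≤ (n : ℝ) - k) :
    GabidulinDecoding.uniformProb ((Fin n → L) × GabidulinDecoding.Grass F n δ)
        (GabidulinDecoding.successEvent F k δ w g) ≤
      ∑ j ∈ Finset.range (w + 1),
        GabidulinDecoding.Abar q m n k j * GabidulinDecoding.guessProb q n k δ j ∧
    ∑ j ∈ Finset.range (w + 1),
        GabidulinDecoding.Abar q m n k j * GabidulinDecoding.guessProb q n k δ j ≤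
      64 * (n : ℝ) * (q : ℝ) ^
        ((m : ℝ) * ((k : ℝ) - n) + (w : ℝ) * ((n : ℝ) + m) - (w : ℝ) ^ 2 -
          (⌈(δ : ℝ) / 2 + w - ((n : ℝ) - k) / 2⌉ : ℝ) *
            (((n : ℝ) + k) / 2 - (⌈(δ : ℝ) / 2⌉ : ℝ))) ∧
    ∀ j : ℕ, GabidulinDecoding.averageCodewords F k g j = GabidulinDecoding.Abar q m n k j := by
  subst hq hm
  have hδ : δ + k ≤ n := by
    have : (δ : ℝ) + k ≤ n := by linarith
    exact_mod_cast this
  have hw : 2 * w + k ≤ n + δ := by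
    rw [GabidulinDecoding.excess] at hδ₁
    have : (2 * w + k : ℝ) ≤ n + δ := by linarith
    exact_mod_cast this
  have hnm : n ≤ Module.finrank F L := by simpa using hg.fintype_card_le_finrank
  have hn : 0 < n := by omega
  exact ⟨GabidulinDecoding.uniformProb_successEvent_le w hg hn hδ,
    GabidulinDecoding.sum_Abar_mul_guessProb_le Fintype.one_lt_card hk hnm hδ hw,
    GabidulinDecoding.averageCodewords_eq hg hn (by omega)⟩
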